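/- A capacitated graph $G=(V,E,\mu)$ is a finite undirected graph with capacities $\mu_e>0$ and an arbitrary orientation of its edges; $B_G\in\mathbb R^{E\times V}$ is its incidence matrix (the row of $e=(a,b)$ is $\mathbb 1_a-\mathbb 1_b$) and $U_G=\mathrm{diag}(\mu)$. Flows $f_1,\dots,f_k\in\mathbb R^E$ meet demands $D=\{\chi_1,\dots,\chi_k\}\subset\mathbb R^V$ if $B_G^Tf_i=\chi_i$ for all $i$; their congestion is $\mathrm{cong}_G(\{f_i\})=\|U_G^{-1}\sum_i|f_i|\|_\infty$, and $\mathrm{opt}_G(D)\in[0,\infty]$ is the minimum congestion of flows meeting $D$ ($\infty$ if there are none). For $S\subseteq V$, $\mu(\partial_G(S))$ is the total capacity of the edges with exactly one endpoint in $S$. Let $G=(V,E,\mu)$ and $G'=(V,E',\mu')$ be capacitated graphs and let $M\in\mathbb R^{E\times E'}$ be produced from $G$ by an $(h,\epsilon,\alpha)$-flow sparsifier with $\epsilon<1$, so that in particular - $|E'|\le h$; - $(1-\epsilon)\,\mu(\partial_G(S))\le\mu'(\partial_{G'}(S))\le(1+\epsilon)\,\mu(\partial_G(S))$ for all $S\subseteq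 V$; - $M$ is an embedding of $G'$ into $G$, i.e. $B_G^TM=B_{G'}^T$, with $\mathrm{cong}(M)=\max_{x\ne0}\|U_G^{-1}Mx\|_\infty/\|U_{G'}^{-1}x\|_\infty\le\alpha$. (No other property of a flow sparsifier, such as its running time or the capacity ratio of $G'$, is needed.) **Theorem.** There is a universal constant $C>0$ such that for all such $G,G',M,h,\epsilon,\alpha$, all $k$, and all sets $D=\{\chi_1,\dots,\chi_k\}$ of $k$ demands between vertex pairs (each $\chi_i=d_i(\mathbb 1_{s_i}-\mathbb 1_{t_i})$ with $s_i,t_i\in V$ and $d_i\ge0$), $$\mathrm{opt}_{G'}(D)\le\frac{C\log(k+1)}{1-\epsilon}\cdot\mathrm{opt}_G(D).$$ If $D$ can be met in $G$, then an optimum flow for $D$ over $G'$ exists, and every optimum flow $\{f_i^\star\}$ for $D$ over $G'$ satisfies $$\mathrm{cong}_G(\{Mf_i^\star\})\le\alpha\cdot\mathrm{opt}_{G'}(D)\le\frac{C\,\alpha\log(k+1)}{1-\epsilon}\cdot\mathrm{opt}_G(D).$$ -/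

import Mathlib

open scoped Matrix

noncomputable section

/-- An undirected capacitated graph on the vertex type `V` with edges indexed by `E`.  The two
endpoints of an edge are listed in an arbitrary order, which serves only to give flows a sign.
Capacities are positive.  Parallel edges (and loops) are allowed. -/
structure CapGraph (V E : Type*) where
  src : E → V
  tgt : E → V
  cap : E → ℝ
  cap_pos : ∀ e, 0 < cap e

namespace CapGraph

variable {V E E' : Type*} [Fintype V] [DecidableEq V] [Fintype E] [Fintype E']

/-- The edge-vertex incidence matrix `B`: the row of an edge `(a, b)` is `1_a - 1_b`. -/
def incidence (G : CapGraph V E) : Matrix E V ℝ :=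
  Matrix.of fun e => Pi.single (G.src e) 1 - Pi.single (G.tgt e) 1

/-- `U⁻¹ f`, the vector of the ratios of flow to capacity. -/
def scaled (G : CapGraph V E) (f : E → ℝ) : E → ℝ := fun e => f e / G.cap e

/-- The total congestion `‖U⁻¹ ∑ᵢ |fᵢ|‖_∞` of a finite family of flows. -/
def congestion (G : CapGraph V E) {k : ℕ} (f : Fin k → E → ℝ) : ℝ :=
  ‖G.scaled (fun e => ∑ i, |f i e|)‖

/-- The flows `fᵢ` form a multicommodity flow meeting the demand vectors `χᵢ`: `Bᵀ fᵢ = χᵢ`. -/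
def Meets (G : CapGraph V E) {k : ℕ} (f : Fin k → E → ℝ) (χ : Fin k → V → ℝ) : Prop :=
  ∀ i, G.incidenceᵀ *ᵥ f i = χ i

/-- The least total congestion of a multicommodity flow meeting the demands; it is `⊤` when
no multicommodity flow meets them. -/
def opt (G : CapGraph V E) {k : ℕ} (χ : Fin k → V → ℝ) : ENNReal :=
  ⨅ (f : Fin k → E → ℝ) (_ : G.Meets f χ), ENNReal.ofReal (G.congestion f)

/-- `f` is an optimum multicommodity flow for the demands `χ`. -/
def IsOptimal (G : CapGraph V E) {k : ℕ} (f : Fin k → E → ℝ) (χ : Fin k → V → ℝ) : Prop :=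
  G.Meets f χ ∧ ∀ g : Fin k → E → ℝ, G.Meets g χ → G.congestion f ≤ G.congestion g

/-- The total capacity `μ(∂S)` of the edges with exactly one endpoint in `S`. -/
def cutCap (G : CapGraph V E) (S : Finset V) : ℝ :=
  ∑ e with ¬(G.src e ∈ S ↔ G.tgt e ∈ S), G.cap e

/-- `M` is an embedding of `G'` into `G`: it sends the unit flow on each edge of `G'` to a flow
in `G` between the endpoints of that edge, i.e. `Bᵀ M = B'ᵀ`. -/
def IsEmbedding (G' : CapGraph V E') (G : CapGraph V E) (M : Matrix E E' ℝ) : Prop :=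
  G.incidenceᵀ * M = G'.incidenceᵀ

/-- The congestion `max_x ‖U⁻¹ M x‖_∞ / ‖U'⁻¹ x‖_∞` of an embedding `M` of `G'` into `G`. -/
def embCongestion (G' : CapGraph V E') (G : CapGraph V E) (M : Matrix E E' ℝ) : ℝ :=
  ⨆ x : E' → ℝ, ‖G.scaled (M *ᵥ x)‖ / ‖G'.scaled x‖

/-- What an `(h, ε, α)`-flow sparsifier guarantees about its output `G'`, `M` on the input `G`.
The bounds on the running times and on the capacity ratio are not required here, so outputs of
flow sparsifiers are special cases. -/
structure IsFlowSparsification (G : CapGraph V E) (G' : CapGraph V E') (M : Matrix E E' ℝ)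
    (h ε α : ℝ) : Prop where
  embedding : IsEmbedding G' G M
  sparsity : (Fintype.card E' : ℝ) ≤ h
  cut_lower : ∀ S : Finset V, (1 - ε) * G.cutCap S ≤ G'.cutCap S
  cut_upper : ∀ S : Finset V, G'.cutCap S ≤ (1 + ε) * G.cutCap S
  flow : embCongestion G' G M ≤ α

end CapGraph

/-- A demand of `d ≥ 0` units from the vertex `s` to the vertex `t`. -/
def IsPairDemand {V : Type*} [DecidableEq V] (χ : V → ℝ) : Prop :=
  ∃ (s t : V) (d : ℝ), 0 ≤ d ∧ χ = d • (Pi.single s 1 - Pi.single t 1)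

end

/-!
The theorem is an approximate max-flow min-cut theorem for multicommodity flows, applied to `G'`.
A flow in `G` of congestion `c` bounds the demand across every cut by `c` times the capacity of the
cut in `G` (`CapGraph.sum_demand_le_congestion_mul_cutCap`), hence by `c / (1 - ε)` times its
capacity in `G'`. It remains to see that this cut condition lets `k` pair demands be routed with a
further loss of `O(log k)` only (`CapGraph.exists_meets_of_cut_condition`).

If they cannot be routed with congestion `c'`, a hyperplane separates them from the compact convex
set of the demands that can be, and it amounts to a potential on the vertices for each commodity
(`CapGraph.exists_potential_of_not_meets`). The vector of potentials maps the vertices into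
`ℓ_∞^k`, and in the distance `δ` of that space
`c' * ∑ₑ μ'ₑ δ(e) < ∑ᵢ dᵢ δ(sᵢ, tᵢ)`.

This contradicts the cut condition, averaged over a family of cuts in the manner of Bourgain's
embedding theorem (`CapGraph.sum_demand_mul_dist_le`). The cuts are the `r`-neighbourhoods of sets
`A` of terminals, with `A` random at each of the `O(log k)` dyadic densities and `r` distributed by
Lebesgue measure. For fixed `A` the radii separating two points have measure at most their
distance (`CapGraph.volume_separatingRadii_le`). Conversely, for every `r < δ(sᵢ, tᵢ) / 2` the
`r`-balls around `sᵢ` and `tᵢ` are disjoint, and at the density matching the smaller ball `A` meets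
exactly one of them with probability at least `1 / 8`
(`CapGraph.one_eighth_le_sum_sampleWeight`).

An optimum flow exists by compactness, and pushing it through `M` costs a factor `α` because the
congestion of `M` dominates the weighted `ℓ₁` norms of its rows (`CapGraph.sum_abs_mul_cap_le`).
-/

namespace CapGraph

open Finset MeasureTheory

/-! ### Congestion -/

section Congestion

variable {V E E' : Type*} [Fintype E] [Fintype E']

lemma congestion_nonneg (G : CapGraph V E) {k : ℕ} (f : Fin k → E → ℝ) : 0 ≤ G.congestion f :=
  norm_nonneg _

lemma congestion_le_iff (G : CapGraph V E) {k : ℕ} (f : Fin k → E → ℝ) {c : ℝ} (hc : 0 ≤ c) :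
    G.congestion f ≤ c ↔ ∀ e, ∑ i, |f i e| ≤ c * G.cap e := by
  unfold congestion scaled
  rw [pi_norm_le_iff_of_nonneg hc]
  refine forall_congr' fun e => ?_
  rw [Real.norm_of_nonneg (div_nonneg (sum_nonneg fun i _ => abs_nonneg _) (G.cap_pos e).le),
    div_le_iff₀ (G.cap_pos e)]

lemma sum_abs_le_congestion_mul_cap (G : CapGraph V E) {k : ℕ} (f : Fin k → E → ℝ) (e : E) :
    ∑ i, |f i e| ≤ G.congestion f * G.cap e :=
  (G.congestion_le_iff f (G.congestion_nonneg f)).1 le_rfl e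

lemma continuous_congestion (G : CapGraph V E) {k : ℕ} :
    Continuous (G.congestion : (Fin k → E → ℝ) → ℝ) := by
  unfold congestion scaled
  fun_prop

lemma isCompact_congestion_le (G : CapGraph V E) {k : ℕ} (c : ℝ) :
    IsCompact {f : Fin k → E → ℝ | G.congestion f ≤ c} := by
  refine (isCompact_Icc (a := fun _ e => -(c * G.cap e))
    (b := fun _ e => c * G.cap e)).of_isClosed_subset
    (isClosed_le G.continuous_congestion continuous_const) fun f hf => ?_
  have hc : 0 ≤ c := (G.congestion_nonneg f).trans hf
  have key : ∀ i e, |f i e| ≤ c * G.cap e := fun i e =>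
    (single_le_sum (f := fun i => |f i e|) (fun i _ => abs_nonneg _) (mem_univ i)).trans
      ((G.congestion_le_iff f hc).1 hf e)
  exact ⟨fun i e => (abs_le.1 (key i e)).1, fun i e => (abs_le.1 (key i e)).2⟩

lemma convex_congestion_le (G : CapGraph V E) {k : ℕ} {c : ℝ} (hc : 0 ≤ c) :
    Convex ℝ {f : Fin k → E → ℝ | G.congestion f ≤ c} := by
  intro f hf g hg a b ha hb hab
  rw [Set.mem_ofPred_eq, congestion_le_iff _ _ hc] at hf hg ⊢
  intro e
  calc ∑ i, |(a • f + b • g) i e| ≤ ∑ i, (a * |f i e| + b * |g i e|) := by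
        refine sum_le_sum fun i _ => ?_
        simpa [abs_mul, abs_of_nonneg ha, abs_of_nonneg hb] using abs_add_le (a * f i e) (b * g i e)
    _ = a * ∑ i, |f i e| + b * ∑ i, |g i e| := by rw [sum_add_distrib, mul_sum, mul_sum]
    _ ≤ a * (c * G.cap e) + b * (c * G.cap e) := by gcongr <;> [exact hf e; exact hg e]
    _ = c * G.cap e := by rw [← add_mul, hab, one_mul]

lemma exists_isOptimal [DecidableEq V] (G : CapGraph V E) {k : ℕ} {χ : Fin k → V → ℝ}
    {f : Fin k → E → ℝ}
    (hf : G.Meets f χ) : ∃ g, G.IsOptimal g χ := by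
  have hclosed : IsClosed {g : Fin k → E → ℝ | G.Meets g χ} := by
    simp only [Meets, Set.ofPred_forall]
    exact isClosed_iInter fun i => isClosed_eq (by fun_prop) continuous_const
  obtain ⟨g, hg, hmin⟩ := ((G.isCompact_congestion_le (G.congestion f)).inter_left
    hclosed).exists_isMinOn ⟨f, hf, le_refl (G.congestion f)⟩ G.continuous_congestion.continuousOn
  refine ⟨g, hg.1, fun g' hg' => ?_⟩
  rcases le_total (G.congestion g') (G.congestion f) with h | h
  · exact hmin ⟨hg', h⟩
  · exact le_trans hg.2 h

lemma opt_le_of_meets [DecidableEq V] (G : CapGraph V E) {k : ℕ} {χ : Fin k → V → ℝ}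
    {f : Fin k → E → ℝ}
    (hf : G.Meets f χ) : G.opt χ ≤ ENNReal.ofReal (G.congestion f) :=
  iInf₂_le f hf

lemma IsOptimal.opt_eq [DecidableEq V] {G : CapGraph V E} {k : ℕ} {χ : Fin k → V → ℝ}
    {f : Fin k → E → ℝ}
    (hf : G.IsOptimal f χ) : G.opt χ = ENNReal.ofReal (G.congestion f) :=
  (G.opt_le_of_meets hf.1).antisymm
    (le_iInf₂ fun g hg => ENNReal.ofReal_le_ofReal (hf.2 g hg))

lemma abs_le_norm_scaled_mul_cap (G : CapGraph V E) (x : E → ℝ) (e : E) :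
    |x e| ≤ ‖G.scaled x‖ * G.cap e := by
  have h := norm_le_pi_norm (G.scaled x) e
  rwa [scaled, Real.norm_eq_abs, abs_div, abs_of_pos (G.cap_pos e), div_le_iff₀ (G.cap_pos e)] at h

lemma bddAbove_embCongestion (G' : CapGraph V E') (G : CapGraph V E) (M : Matrix E E' ℝ) :
    BddAbove (Set.range fun x : E' → ℝ => ‖G.scaled (M *ᵥ x)‖ / ‖G'.scaled x‖) := by
  have hnn : 0 ≤ ∑ e, (∑ e', |M e e'| * G'.cap e') / G.cap e :=
    sum_nonneg fun e _ => div_nonneg (sum_nonneg fun e' _ =>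
      mul_nonneg (abs_nonneg _) (G'.cap_pos e').le) (G.cap_pos e).le
  refine ⟨∑ e, (∑ e', |M e e'| * G'.cap e') / G.cap e, ?_⟩
  rintro _ ⟨x, rfl⟩
  refine div_le_of_le_mul₀ (norm_nonneg _) hnn ?_
  rw [pi_norm_le_iff_of_nonneg (mul_nonneg hnn (norm_nonneg _))]
  intro e
  have hle : |(M *ᵥ x) e| ≤ (∑ e', |M e e'| * G'.cap e') * ‖G'.scaled x‖ := by
    rw [sum_mul]
    refine (abs_sum_le_sum_abs _ _).trans (sum_le_sum fun e' _ => ?_)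
    rw [abs_mul, mul_assoc, mul_comm (G'.cap e')]
    gcongr
    exact G'.abs_le_norm_scaled_mul_cap x e'
  rw [scaled, Real.norm_eq_abs, abs_div, abs_of_pos (G.cap_pos e)]
  calc |(M *ᵥ x) e| / G.cap e
      ≤ (∑ e', |M e e'| * G'.cap e') * ‖G'.scaled x‖ / G.cap e := by
        have := (G.cap_pos e).le
        gcongr
    _ = (∑ e', |M e e'| * G'.cap e') / G.cap e * ‖G'.scaled x‖ := by ring
    _ ≤ _ := by
        gcongr
        exact single_le_sum (f := fun e => (∑ e', |M e e'| * G'.cap e') / G.cap e)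
          (fun e _ => div_nonneg (sum_nonneg fun e' _ =>
            mul_nonneg (abs_nonneg _) (G'.cap_pos e').le) (G.cap_pos e).le) (mem_univ e)

lemma embCongestion_nonneg (G' : CapGraph V E') (G : CapGraph V E) (M : Matrix E E' ℝ) :
    0 ≤ embCongestion G' G M :=
  Real.iSup_nonneg fun _ => div_nonneg (norm_nonneg _) (norm_nonneg _)

/-- The congestion of an embedding dominates each weighted `ℓ₁` row norm: a row attains its norm
on the vector that saturates every edge with the sign of the corresponding entry. -/
lemma sum_abs_mul_cap_le (G' : CapGraph V E') (G : CapGraph V E) (M : Matrix E E' ℝ) (e : E) :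
    ∑ e', |M e e'| * G'.cap e' ≤ embCongestion G' G M * G.cap e := by
  set x : E' → ℝ := fun e' => SignType.sign (M e e') * G'.cap e' with hx
  have hMx : (M *ᵥ x) e = ∑ e', |M e e'| * G'.cap e' := by
    refine sum_congr rfl fun e' _ => ?_
    rw [hx, ← mul_assoc, self_mul_sign]
  have hx1 : ‖G'.scaled x‖ ≤ 1 := by
    rw [pi_norm_le_iff_of_nonneg zero_le_one]
    intro e'
    rw [scaled, hx, mul_div_cancel_right₀ _ (G'.cap_pos e').ne']
    rcases lt_trichotomy (M e e') 0 with h | h | h <;> simp [h]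
  have hratio : ‖G.scaled (M *ᵥ x)‖ ≤ embCongestion G' G M * ‖G'.scaled x‖ := by
    rcases (norm_nonneg (G'.scaled x)).eq_or_lt with h0 | h0
    · have hx0 : x = 0 := by
        ext e'
        have := G'.abs_le_norm_scaled_mul_cap x e'
        rw [← h0, zero_mul] at this
        exact abs_nonpos_iff.1 this
      have : G.scaled (M *ᵥ x) = 0 := by
        ext e
        simp [scaled, hx0]
      rw [this, ← h0, norm_zero, mul_zero]
    · rw [← div_le_iff₀ h0]
      exact le_ciSup (bddAbove_embCongestion G' G M) x
  calc ∑ e', |M e e'| * G'.cap e' ≤ |(M *ᵥ x) e| := hMx ▸ le_abs_self _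
    _ ≤ ‖G.scaled (M *ᵥ x)‖ * G.cap e := G.abs_le_norm_scaled_mul_cap _ e
    _ ≤ embCongestion G' G M * G.cap e := by
        have := (G.cap_pos e).le
        gcongr
        exact hratio.trans (mul_le_of_le_one_right (embCongestion_nonneg G' G M) hx1)

lemma congestion_mulVec_le (G' : CapGraph V E') (G : CapGraph V E) (M : Matrix E E' ℝ) {k : ℕ}
    (f : Fin k → E' → ℝ) :
    G.congestion (fun i => M *ᵥ f i) ≤ embCongestion G' G M * G'.congestion f := by
  rw [congestion_le_iff _ _ (mul_nonneg (embCongestion_nonneg G' G M) (G'.congestion_nonneg f))]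
  intro e
  calc ∑ i, |(M *ᵥ f i) e| ≤ ∑ i, ∑ e', |M e e'| * |f i e'| := by
        refine sum_le_sum fun i _ => ?_
        simp only [← abs_mul]
        exact abs_sum_le_sum_abs _ _
    _ = ∑ e', |M e e'| * ∑ i, |f i e'| := by
        rw [sum_comm]
        simp only [mul_sum]
    _ ≤ ∑ e', |M e e'| * (G'.congestion f * G'.cap e') := by
        gcongr
        exact G'.sum_abs_le_congestion_mul_cap f _
    _ = G'.congestion f * ∑ e', |M e e'| * G'.cap e' := by
        rw [mul_sum]
        exact sum_congr rfl fun _ _ => by ring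
    _ ≤ G'.congestion f * (embCongestion G' G M * G.cap e) := by
        have := G'.congestion_nonneg f
        gcongr
        exact sum_abs_mul_cap_le G' G M e
    _ = embCongestion G' G M * G'.congestion f * G.cap e := by ring

end Congestion

/-! ### The cut condition -/

section Cut

variable {V E : Type*} [Fintype V] [DecidableEq V] [Fintype E]

lemma incidence_transpose_mulVec_dotProduct (G : CapGraph V E) (f : E → ℝ) (p : V → ℝ) :
    ∑ v, (G.incidenceᵀ *ᵥ f) v * p v = ∑ e, f e * (p (G.src e) - p (G.tgt e)) := by
  simp only [Matrix.mulVec, dotProduct, Matrix.transpose_apply, incidence, Matrix.of_apply,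
    Pi.sub_apply, sum_mul]
  rw [sum_comm]
  refine sum_congr rfl fun e _ => ?_
  simp_rw [mul_right_comm _ (f e) (p _), mul_comm _ (f e)]
  rw [← mul_sum]
  congr 1
  simp [sub_mul, sum_sub_distrib, Pi.single_apply]

lemma sum_pairDemand_mul (s t : V) (d : ℝ) (p : V → ℝ) :
    ∑ v, (d • (Pi.single s 1 - Pi.single t 1 : V → ℝ)) v * p v = d * (p s - p t) := by
  simp only [Pi.smul_apply, Pi.sub_apply, smul_eq_mul, mul_assoc]
  rw [← mul_sum]
  congr 1
  simp [sub_mul, sum_sub_distrib, Pi.single_apply]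

/-- The easy direction of max-flow min-cut: the demand across a cut is at most the congestion
times the capacity of the cut. -/
lemma sum_demand_le_congestion_mul_cutCap (G : CapGraph V E) {k : ℕ} {s t : Fin k → V}
    {d : Fin k → ℝ} (hd : ∀ i, 0 ≤ d i) {f : Fin k → E → ℝ}
    (hf : G.Meets f fun i => d i • (Pi.single (s i) 1 - Pi.single (t i) 1)) (S : Finset V) :
    ∑ i with ¬(s i ∈ S ↔ t i ∈ S), d i ≤ G.congestion f * G.cutCap S := by
  have hone : ∀ i, (if ¬(s i ∈ S ↔ t i ∈ S) then d i else 0) ≤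
      ∑ e, if ¬(G.src e ∈ S ↔ G.tgt e ∈ S) then |f i e| else 0 := by
    intro i
    set p : V → ℝ := fun v => if v ∈ S then 1 else 0 with hp
    have h1 := G.incidence_transpose_mulVec_dotProduct (f i) p
    rw [hf i, sum_pairDemand_mul] at h1
    calc (if ¬(s i ∈ S ↔ t i ∈ S) then d i else 0) = |d i * (p (s i) - p (t i))| := by
          rw [abs_mul, abs_of_nonneg (hd i)]
          by_cases h1 : s i ∈ S <;> by_cases h2 : t i ∈ S <;> simp [hp, h1, h2]
      _ ≤ ∑ e, |f i e * (p (G.src e) - p (G.tgt e))| := h1 ▸ abs_sum_le_sum_abs _ _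
      _ = _ := by
          refine sum_congr rfl fun e _ => ?_
          by_cases h1 : G.src e ∈ S <;> by_cases h2 : G.tgt e ∈ S <;> simp [hp, h1, h2]
  calc ∑ i with ¬(s i ∈ S ↔ t i ∈ S), d i
      = ∑ i, if ¬(s i ∈ S ↔ t i ∈ S) then d i else 0 := sum_filter _ _
    _ ≤ ∑ i, ∑ e, if ¬(G.src e ∈ S ↔ G.tgt e ∈ S) then |f i e| else 0 :=
        sum_le_sum fun i _ => hone i
    _ = ∑ e with ¬(G.src e ∈ S ↔ G.tgt e ∈ S), ∑ i, |f i e| := by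
        rw [sum_comm, sum_filter]
        refine sum_congr rfl fun e _ => ?_
        split_ifs <;> simp
    _ ≤ ∑ e with ¬(G.src e ∈ S ↔ G.tgt e ∈ S), G.congestion f * G.cap e :=
        sum_le_sum fun e _ => G.sum_abs_le_congestion_mul_cap f e
    _ = G.congestion f * G.cutCap S := by rw [cutCap, mul_sum]

end Cut

/-! ### Linear programming duality for multicommodity flows -/

section Duality

variable {V E : Type*} [Fintype V] [DecidableEq V] [Fintype E]

/-- If no flow of congestion at most `c` meets the demands, a hyperplane separates the demands from
those that can be met, and its coefficients are potentials `p · i`, one for each commodity.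
Seen as points `p v` of `ℓ_∞^k`, the potentials place the vertices in a metric space where the
edges are so short that the total capacity-weighted length certifies infeasibility. -/
lemma exists_potential_of_not_meets (G : CapGraph V E) {k : ℕ} [NeZero k] {s t : Fin k → V}
    {d : Fin k → ℝ} (hd : ∀ i, 0 ≤ d i) {c : ℝ} (hc : 0 ≤ c)
    (hno : ¬∃ f : Fin k → E → ℝ, G.congestion f ≤ c ∧
      G.Meets f fun i => d i • (Pi.single (s i) 1 - Pi.single (t i) 1)) :
    ∃ p : V → Fin k → ℝ,
      c * ∑ e, G.cap e * dist (p (G.src e)) (p (G.tgt e)) <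
        ∑ i, d i * dist (p (s i)) (p (t i)) := by
  set χ : Fin k → V → ℝ := fun i => d i • (Pi.single (s i) 1 - Pi.single (t i) 1) with hχ
  let T : (Fin k → E → ℝ) →ₗ[ℝ] (Fin k → V → ℝ) :=
    LinearMap.pi fun i => G.incidenceᵀ.mulVecLin ∘ₗ LinearMap.proj i
  have hT : Continuous T := T.continuous_of_finiteDimensional
  have hmem : χ ∉ T '' {f | G.congestion f ≤ c} := by
    rintro ⟨f, hf, hfχ⟩
    exact hno ⟨f, hf, fun i => congrFun hfχ i⟩
  -- The separating functional `F` is the pairing with the potentials `p`.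
  obtain ⟨F, u, hFu, huF⟩ := geometric_hahn_banach_closed_point
    ((G.convex_congestion_le hc).linear_image T)
    ((G.isCompact_congestion_le c).image hT).isClosed hmem
  let p : V → Fin k → ℝ := fun v i => F (Pi.single i (Pi.single v 1))
  have hF : ∀ x, F x = ∑ i, ∑ v, x i v * p v i := by
    intro x
    have hx : x = ∑ i, ∑ v, x i v • (Pi.single i (Pi.single v 1) : Fin k → V → ℝ) := by
      ext i v
      simp [Finset.sum_apply, Pi.single_apply, ite_apply]
    conv_lhs => rw [hx]
    simp [map_sum, p]
  -- The most profitable flow sends everything along an edge for the commodity whose potential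
  -- differs most between its ends, in the direction of that difference.
  have hmax : ∀ e, ∃ i, dist (p (G.src e)) (p (G.tgt e)) = |p (G.src e) i - p (G.tgt e) i| := by
    intro e
    obtain ⟨i, hi⟩ := Finite.exists_max fun i => dist (p (G.src e) i) (p (G.tgt e) i)
    exact ⟨i, ((dist_pi_le_iff dist_nonneg).2 hi).antisymm (dist_le_pi_dist _ _ i)⟩
  choose m hm using hmax
  let f : Fin k → E → ℝ := fun i e =>
    if i = m e then c * G.cap e * SignType.sign (p (G.src e) i - p (G.tgt e) i) else 0
  have hfc : G.congestion f ≤ c := by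
    rw [congestion_le_iff _ _ hc]
    intro e
    have hnn : 0 ≤ c * G.cap e := mul_nonneg hc (G.cap_pos e).le
    rw [sum_eq_single (m e) (fun i _ hi => by simp [f, hi]) (by simp)]
    simp only [f, if_true, abs_mul, abs_of_nonneg hc, abs_of_pos (G.cap_pos e)]
    refine mul_le_of_le_one_right hnn ?_
    rcases lt_trichotomy (p (G.src e) (m e) - p (G.tgt e) (m e)) 0 with h | h | h <;> simp [h]
  have hlow : F (T f) = c * ∑ e, G.cap e * dist (p (G.src e)) (p (G.tgt e)) := by
    rw [hF]
    calc ∑ i, ∑ v, (G.incidenceᵀ *ᵥ f i) v * p v i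
        = ∑ i, ∑ e, f i e * (p (G.src e) i - p (G.tgt e) i) :=
          sum_congr rfl fun i _ => G.incidence_transpose_mulVec_dotProduct (f i) fun v => p v i
      _ = ∑ e, c * (G.cap e * dist (p (G.src e)) (p (G.tgt e))) := by
          rw [sum_comm]
          refine sum_congr rfl fun e _ => ?_
          rw [sum_eq_single (m e) (fun i _ hi => by simp [f, hi]) (by simp), hm,
            ← sign_mul_self (p (G.src e) (m e) - p (G.tgt e) (m e))]
          simp only [f, if_true]
          ring
      _ = _ := by rw [mul_sum]
  have hhigh : F χ ≤ ∑ i, d i * dist (p (s i)) (p (t i)) := by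
    rw [hF]
    refine sum_le_sum fun i _ => ?_
    rw [hχ, sum_pairDemand_mul (s i) (t i) (d i) fun v => p v i]
    exact mul_le_mul_of_nonneg_left
      ((le_abs_self _).trans (dist_le_pi_dist (p (s i)) (p (t i)) i)) (hd i)
  exact ⟨p, by linarith [hFu _ ⟨f, hfc, rfl⟩]⟩

end Duality

/-! ### Random subsets at dyadic densities -/

section Sampling

variable {I : Type*} [Fintype I]

/-- The probability of the set `A` when every element is left out independently with
probability `q`. -/
def sampleWeight (q : ℝ) (A : Finset I) : ℝ :=
  (1 - q) ^ #A * q ^ (Fintype.card I - #A)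

lemma sampleWeight_nonneg {q : ℝ} (h0 : 0 ≤ q) (h1 : q ≤ 1) (A : Finset I) :
    0 ≤ sampleWeight q A :=
  mul_nonneg (pow_nonneg (sub_nonneg.2 h1) _) (pow_nonneg h0 _)

lemma sum_sampleWeight_disjoint [DecidableEq I] (q : ℝ) (P : Finset I) :
    ∑ A with Disjoint A P, sampleWeight q A = q ^ #P := by
  have hset : (univ.filter fun A : Finset I => Disjoint A P) = Pᶜ.powerset := by
    ext A
    simp [le_compl_iff_disjoint_right]
  have hcard : #P + #Pᶜ = Fintype.card I := card_add_card_compl P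
  calc ∑ A with Disjoint A P, sampleWeight q A
      = ∑ A ∈ Pᶜ.powerset, q ^ #P * ((1 - q) ^ #A * q ^ (#Pᶜ - #A)) := by
        rw [hset]
        refine sum_congr rfl fun A hA => ?_
        have hle : #A ≤ #Pᶜ := card_le_card (mem_powerset.1 hA)
        rw [sampleWeight, show Fintype.card I - #A = #P + (#Pᶜ - #A) by omega, pow_add]
        ring
    _ = q ^ #P := by rw [← mul_sum, sum_pow_mul_eq_add_pow]; simp

lemma sum_sampleWeight (q : ℝ) : ∑ A : Finset I, sampleWeight q A = 1 := by
  classical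
  simpa using sum_sampleWeight_disjoint q (∅ : Finset I)

lemma pow_sub_pow_le_sum_sampleWeight [DecidableEq I] {q : ℝ} (h0 : 0 ≤ q) (h1 : q ≤ 1)
    {P Q : Finset I} (hPQ : Disjoint P Q) :
    q ^ #P - q ^ (#P + #Q) ≤ ∑ A with ¬(Disjoint A P ↔ Disjoint A Q), sampleWeight q A := by
  rw [← card_union_of_disjoint hPQ, ← sum_sampleWeight_disjoint q P,
    ← sum_sampleWeight_disjoint q (P ∪ Q), sum_filter, sum_filter, sum_filter, ← sum_sub_distrib]
  refine sum_le_sum fun A _ => ?_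
  have := sampleWeight_nonneg h0 h1 A
  by_cases hP : Disjoint A P <;> by_cases hQ : Disjoint A Q <;>
    simp [disjoint_union_right, hP, hQ, this]

/-- The omission probability `q` at level `j`, chosen so that a set of `2 ^ j` elements is missed
with probability exactly `1 / 2`. -/
noncomputable def omitProb (j : ℕ) : ℝ := (1 / 2 : ℝ) ^ ((2 ^ j : ℕ) : ℝ)⁻¹

lemma omitProb_nonneg (j : ℕ) : 0 ≤ omitProb j := Real.rpow_nonneg (by norm_num) _

lemma omitProb_le_one (j : ℕ) : omitProb j ≤ 1 :=
  Real.rpow_le_one (by norm_num) (by norm_num) (by positivity)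

lemma omitProb_pow (j : ℕ) : omitProb j ^ 2 ^ j = 1 / 2 :=
  Real.rpow_inv_natCast_pow (by norm_num) (by positivity)

/-- At the level matching the size of the smaller of two disjoint sets, the random set misses the
smaller one and meets the other with probability at least `1 / 8`. -/
lemma one_eighth_le_sum_sampleWeight [DecidableEq I] {P Q : Finset I}
    (hPQ : Disjoint P Q) (hP : P.Nonempty)
    (hQ : Q.Nonempty) :
    1 / 8 ≤ ∑ j ∈ range (Nat.log 2 (Fintype.card I) + 1),
      ∑ A with ¬(Disjoint A P ↔ Disjoint A Q), sampleWeight (omitProb j) A := by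
  wlog hle : #P ≤ #Q generalizing P Q
  · simp_rw [iff_comm (a := Disjoint _ P)]
    exact this hPQ.symm hQ hP (le_of_not_ge hle)
  set j := Nat.log 2 #P
  set q := omitProb j
  have h0 : 0 ≤ q := omitProb_nonneg j
  have h1 : q ≤ 1 := omitProb_le_one j
  have hhalf : q ^ 2 ^ j = 1 / 2 := omitProb_pow j
  have hup : q ^ #P ≤ 1 / 2 :=
    hhalf ▸ pow_le_pow_of_le_one h0 h1 (Nat.pow_log_le_self 2 hP.card_pos.ne')
  have hlo : 1 / 4 ≤ q ^ #P := by
    calc (1 / 4 : ℝ) = q ^ 2 ^ (j + 1) := by rw [pow_succ 2 j, pow_mul, hhalf]; norm_num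
      _ ≤ q ^ #P := pow_le_pow_of_le_one h0 h1 (Nat.lt_pow_succ_log_self one_lt_two _).le
  have hQP : q ^ #Q ≤ q ^ #P := pow_le_pow_of_le_one h0 h1 hle
  have hj : j ∈ range (Nat.log 2 (Fintype.card I) + 1) :=
    mem_range.2 (Nat.lt_succ_of_le (Nat.log_mono_right (card_le_univ P)))
  calc (1 / 8 : ℝ) ≤ q ^ #P - q ^ (#P + #Q) := by rw [pow_add]; nlinarith
    _ ≤ ∑ A with ¬(Disjoint A P ↔ Disjoint A Q), sampleWeight q A :=
        pow_sub_pow_le_sum_sampleWeight h0 h1 hPQ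
    _ ≤ _ := single_le_sum (f := fun j => ∑ A with ¬(Disjoint A P ↔ Disjoint A Q),
        sampleWeight (omitProb j) A) (fun j _ => sum_nonneg fun A _ =>
          sampleWeight_nonneg (omitProb_nonneg j) (omitProb_le_one j) A) hj

end Sampling

/-! ### Random neighbourhood cuts of a metric space -/

section Neighbourhood

variable {I X : Type*} [PseudoMetricSpace X]

/-- `Near τ A r x` means that `x` is within distance `r` of one of the terminals `τ i`, `i ∈ A`. -/
def Near (τ : I → X) (A : Finset I) (r : ℝ) (x : X) : Prop :=
  ∃ i ∈ A, dist x (τ i) ≤ r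

/-- The radii `r` for which the `r`-neighbourhood of `τ '' A` separates `x` from `y`. -/
def separatingRadii (τ : I → X) (A : Finset I) (x y : X) : Set ℝ :=
  {r | ¬(Near τ A r x ↔ Near τ A r y)}

lemma Near.of_dist {τ : I → X} {A : Finset I} {r r' : ℝ} {x y : X} (h : Near τ A r x)
    (hr : r + dist x y ≤ r') : Near τ A r' y := by
  obtain ⟨i, hi, hxi⟩ := h
  refine ⟨i, hi, ?_⟩
  linarith [dist_triangle_left y (τ i) x]

lemma measurableSet_near (τ : I → X) (A : Finset I) (x : X) :
    MeasurableSet {r | Near τ A r x} := by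
  have : {r | Near τ A r x} = ⋃ i ∈ A, Set.Ici (dist x (τ i)) := by
    ext r
    simp [Near]
  rw [this]
  exact Finset.measurableSet_biUnion _ fun i _ => measurableSet_Ici

lemma measurableSet_separatingRadii (τ : I → X) (A : Finset I) (x y : X) :
    MeasurableSet (separatingRadii τ A x y) :=
  ((measurableSet_near τ A x).iff (measurableSet_near τ A y)).compl

/-- The distance to a set is 1-Lipschitz, stated for the neighbourhoods of the set. -/
lemma volume_separatingRadii_le (τ : I → X) (A : Finset I) (x y : X) :
    volume (separatingRadii τ A x y) ≤ ENNReal.ofReal (dist x y) := by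
  refine (Real.volume_le_diam _).trans (Metric.ediam_le fun r hr r' hr' => ?_)
  rw [edist_dist]
  refine ENNReal.ofReal_le_ofReal ?_
  wlog hle : r ≤ r' generalizing r r'
  · rw [dist_comm]
    exact this r' hr' r hr (le_of_not_ge hle)
  rw [dist_comm, Real.dist_eq, abs_of_nonneg (sub_nonneg.2 hle)]
  by_contra! hlt
  -- Whichever point is near at radius `r`, both are near at radius `r'`.
  refine hr' (iff_of_true ?_ ?_)
  all_goals
    by_cases hx : Near τ A r x
    · first
        | exact hx.of_dist (by rw [dist_self]; linarith)
        | exact hx.of_dist (by linarith)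
    · have hy : Near τ A r y := by
        by_contra hy
        exact hr (iff_of_false hx hy)
      first
        | exact hy.of_dist (by rw [dist_self]; linarith)
        | exact hy.of_dist (by rw [dist_comm]; linarith)

lemma integrable_indicator_separatingRadii (τ : I → X) (A : Finset I) (x y : X) :
    Integrable ((separatingRadii τ A x y).indicator (1 : ℝ → ℝ)) :=
  (integrable_indicator_iff (measurableSet_separatingRadii τ A x y)).2
    (integrableOn_const ((volume_separatingRadii_le τ A x y).trans_lt ENNReal.ofReal_lt_top).ne)

variable [Fintype I]

/-- The expected number of dyadic levels at which the `r`-neighbourhood of a random set of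
terminals separates `x` from `y`. -/
noncomputable def separation (τ : I → X) (x y : X) (r : ℝ) : ℝ :=
  ∑ j ∈ range (Nat.log 2 (Fintype.card I) + 1), ∑ A : Finset I,
    sampleWeight (omitProb j) A * (separatingRadii τ A x y).indicator 1 r

lemma separation_nonneg (τ : I → X) (x y : X) (r : ℝ) : 0 ≤ separation τ x y r :=
  sum_nonneg fun j _ => sum_nonneg fun A _ =>
    mul_nonneg (sampleWeight_nonneg (omitProb_nonneg j) (omitProb_le_one j) A)
      (Set.indicator_nonneg (fun _ _ => zero_le_one) _)

lemma sum_mul_separation {ι : Type*} [Fintype ι] (τ : I → X) (w : ι → ℝ) (x y : ι → X) (r : ℝ) :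
    ∑ i, w i * separation τ (x i) (y i) r =
      ∑ j ∈ range (Nat.log 2 (Fintype.card I) + 1), ∑ A : Finset I,
        sampleWeight (omitProb j) A *
          ∑ i, w i * (separatingRadii τ A (x i) (y i)).indicator 1 r := by
  simp only [separation, mul_sum]
  rw [sum_comm]
  refine sum_congr rfl fun j _ => ?_
  rw [sum_comm]
  exact sum_congr rfl fun A _ => sum_congr rfl fun i _ => by ring

lemma integrable_separation (τ : I → X) (x y : X) : Integrable (separation τ x y) :=
  integrable_finsetSum _ fun _ _ => integrable_finsetSum _ fun A _ =>
    (integrable_indicator_separatingRadii τ A x y).const_mul _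

lemma integral_separation_le (τ : I → X) (x y : X) :
    ∫ r, separation τ x y r ≤ (Nat.log 2 (Fintype.card I) + 1 : ℕ) * dist x y := by
  have hint := fun A => integrable_indicator_separatingRadii τ A x y
  have hle : ∀ A, ∫ r, (separatingRadii τ A x y).indicator (1 : ℝ → ℝ) r ≤ dist x y := by
    intro A
    rw [integral_indicator_one (measurableSet_separatingRadii τ A x y)]
    exact ENNReal.toReal_le_of_le_ofReal dist_nonneg (volume_separatingRadii_le τ A x y)
  unfold separation
  rw [integral_finsetSum _ fun _ _ => integrable_finsetSum _ fun A _ => (hint A).const_mul _]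
  calc _ ≤ ∑ j ∈ range (Nat.log 2 (Fintype.card I) + 1), dist x y := by
        refine sum_le_sum fun j _ => ?_
        rw [integral_finsetSum _ fun A _ => (hint A).const_mul _]
        calc _ ≤ ∑ A : Finset I, sampleWeight (omitProb j) A * dist x y := by
              refine sum_le_sum fun A _ => ?_
              rw [integral_const_mul]
              exact mul_le_mul_of_nonneg_left (hle A)
                (sampleWeight_nonneg (omitProb_nonneg j) (omitProb_le_one j) A)
          _ = dist x y := by rw [← sum_mul, sum_sampleWeight, one_mul]
    _ = _ := by rw [sum_const, card_range, nsmul_eq_mul]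

/-- For a radius below half the distance of two terminals, the balls around them are disjoint and
nonempty, and the neighbourhood of `A` separates them when `A` meets exactly one of the balls. -/
lemma one_eighth_le_separation (τ : I → X) (a b : I) {r : ℝ} (h0 : 0 ≤ r)
    (hr : r < dist (τ a) (τ b) / 2) : 1 / 8 ≤ separation τ (τ a) (τ b) r := by
  classical
  set P : I → Finset I := fun a => univ.filter fun i => dist (τ a) (τ i) ≤ r with hP
  have hself : ∀ a, (P a).Nonempty := fun a => ⟨a, by simp [hP, h0]⟩
  have hdisj : Disjoint (P a) (P b) := by
    refine disjoint_left.2 fun i hia hib => ?_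
    simp only [hP, mem_filter, mem_univ, true_and] at hia hib
    linarith [dist_triangle_right (τ a) (τ b) (τ i)]
  have hnear : ∀ A a, Near τ A r (τ a) ↔ ¬Disjoint A (P a) := by
    intro A a
    simp [Near, hP, Finset.not_disjoint_iff]
  refine (one_eighth_le_sum_sampleWeight hdisj (hself a) (hself b)).trans_eq ?_
  refine sum_congr rfl fun j _ => ?_
  rw [sum_filter]
  refine sum_congr rfl fun A _ => ?_
  simp only [Set.indicator_apply, separatingRadii, Set.mem_ofPred_eq, hnear, not_iff_not,
    Pi.one_apply, mul_ite, mul_one, mul_zero]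

lemma dist_div_le_integral_separation (τ : I → X) (a b : I) :
    dist (τ a) (τ b) / 16 ≤ ∫ r, separation τ (τ a) (τ b) r := by
  have hfin : volume (Set.Ico 0 (dist (τ a) (τ b) / 2)) ≠ ⊤ := by simp
  calc dist (τ a) (τ b) / 16
      = ∫ r, (Set.Ico 0 (dist (τ a) (τ b) / 2)).indicator (fun _ => (1 / 8 : ℝ)) r := by
        rw [integral_indicator_const _ measurableSet_Ico,
          Real.volume_real_Ico_of_le (by positivity), smul_eq_mul]
        ring
    _ ≤ _ := by
        refine integral_mono ((integrable_indicator_iff measurableSet_Ico).2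
          (integrableOn_const hfin)) (integrable_separation τ _ _) fun r => ?_
        refine Set.indicator_le' (fun r hr => one_eighth_le_separation τ a b hr.1 hr.2)
          (fun r _ => separation_nonneg τ _ _ r) r

end Neighbourhood

/-! ### Approximate max-flow min-cut -/

section MaxFlow

variable {V E : Type*} [Fintype V] [DecidableEq V] [Fintype E]

/-- Under the cut condition, demands cannot be longer than edges by more than a logarithmic factor
in any metric: average the cut condition over the random neighbourhood cuts. -/
lemma sum_demand_mul_dist_le (G : CapGraph V E) {X : Type*} [PseudoMetricSpace X] (p : V → X)
    {k : ℕ} {s t : Fin k → V} {d : Fin k → ℝ} (hd : ∀ i, 0 ≤ d i) {c : ℝ} (hc : 0 ≤ c)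
    (hcut : ∀ S : Finset V, ∑ i with ¬(s i ∈ S ↔ t i ∈ S), d i ≤ c * G.cutCap S) :
    ∑ i, d i * dist (p (s i)) (p (t i)) ≤
      16 * (Nat.log 2 (k + k) + 1 : ℕ) * c * ∑ e, G.cap e * dist (p (G.src e)) (p (G.tgt e)) := by
  classical
  let τ : Fin k ⊕ Fin k → X := Sum.elim (p ∘ s) (p ∘ t)
  have hpoint : ∀ r, ∑ i, d i * separation τ (p (s i)) (p (t i)) r ≤
      c * ∑ e, G.cap e * separation τ (p (G.src e)) (p (G.tgt e)) r := by
    intro r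
    have hA : ∀ A, ∑ i, d i * (separatingRadii τ A (p (s i)) (p (t i))).indicator 1 r ≤
        c * ∑ e, G.cap e * (separatingRadii τ A (p (G.src e)) (p (G.tgt e))).indicator 1 r := by
      intro A
      have h := hcut (univ.filter fun v => Near τ A r (p v))
      simpa only [cutCap, sum_filter, mem_filter, mem_univ, true_and, Set.indicator_apply,
        separatingRadii, Set.mem_ofPred_eq, Pi.one_apply, mul_ite, mul_one, mul_zero] using h
    rw [sum_mul_separation τ d (fun i => p (s i)) (fun i => p (t i)),
      sum_mul_separation τ G.cap (fun e => p (G.src e)) (fun e => p (G.tgt e)), mul_sum]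
    refine sum_le_sum fun j _ => ?_
    rw [mul_sum]
    refine sum_le_sum fun A _ => ?_
    rw [mul_left_comm]
    exact mul_le_mul_of_nonneg_left (hA A)
      (sampleWeight_nonneg (omitProb_nonneg j) (omitProb_le_one j) A)
  have hi := fun x y => integrable_separation τ x y
  have hintegral := integral_mono
    (integrable_finsetSum univ fun i _ => (hi (p (s i)) (p (t i))).const_mul (d i))
    ((integrable_finsetSum univ fun e _ =>
      (hi (p (G.src e)) (p (G.tgt e))).const_mul (G.cap e)).const_mul c) hpoint
  rw [integral_const_mul, integral_finsetSum _ fun i _ => (hi _ _).const_mul _,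
    integral_finsetSum _ fun i _ => (hi _ _).const_mul _] at hintegral
  simp only [integral_const_mul] at hintegral
  have hcard : Fintype.card (Fin k ⊕ Fin k) = k + k := by simp
  calc ∑ i, d i * dist (p (s i)) (p (t i))
      = 16 * ∑ i, d i * (dist (p (s i)) (p (t i)) / 16) := by
        rw [mul_sum]
        exact sum_congr rfl fun _ _ => by ring
    _ ≤ 16 * ∑ i, d i * ∫ r, separation τ (p (s i)) (p (t i)) r := by
        gcongr with i
        · exact hd i
        · exact dist_div_le_integral_separation τ (Sum.inl i) (Sum.inr i)
    _ ≤ 16 * (c * ∑ e, G.cap e * ∫ r, separation τ (p (G.src e)) (p (G.tgt e)) r) := by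
        gcongr
    _ ≤ 16 * (c * ∑ e, G.cap e *
          ((Nat.log 2 (k + k) + 1 : ℕ) * dist (p (G.src e)) (p (G.tgt e)))) := by
        gcongr with e
        · exact (G.cap_pos e).le
        · exact hcard ▸ integral_separation_le τ (p (G.src e)) (p (G.tgt e))
    _ = _ := by
        simp_rw [mul_left_comm (G.cap _), ← mul_sum]
        ring

/-- The approximate max-flow min-cut theorem for multicommodity flows, with the factor
`O(log k)`: the number of terminals is at most `k + k`. -/
theorem exists_meets_of_cut_condition (G : CapGraph V E) {k : ℕ} {s t : Fin k → V} {d : Fin k → ℝ}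
    (hd : ∀ i, 0 ≤ d i) {c : ℝ} (hc : 0 ≤ c)
    (hcut : ∀ S : Finset V, ∑ i with ¬(s i ∈ S ↔ t i ∈ S), d i ≤ c * G.cutCap S) :
    ∃ f : Fin k → E → ℝ, G.congestion f ≤ 16 * (Nat.log 2 (k + k) + 1 : ℕ) * c ∧
      G.Meets f fun i => d i • (Pi.single (s i) 1 - Pi.single (t i) 1) := by
  rcases Nat.eq_zero_or_pos k with rfl | hk
  · refine ⟨0, (G.congestion_le_iff _ (by positivity)).2 fun e => ?_, fun i => i.elim0⟩
    simpa using mul_nonneg (mul_nonneg (by norm_num) hc) (G.cap_pos e).le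
  · have : NeZero k := ⟨hk.ne'⟩
    by_contra hno
    obtain ⟨p, hp⟩ := G.exists_potential_of_not_meets hd (by positivity) hno
    exact hp.not_ge (G.sum_demand_mul_dist_le p hd hc hcut)

end MaxFlow

lemma natLog_add_one_le (k : ℕ) (hk : 1 ≤ k) :
    ((Nat.log 2 (k + k) + 1 : ℕ) : ℝ) ≤ 3 / Real.log 2 * Real.log (k + 1) := by
  have hlog2 : 0 < Real.log 2 := Real.log_pos one_lt_two
  have hk' : (1 : ℝ) ≤ k := by exact_mod_cast hk
  have h1 : (Nat.log 2 (k + k) : ℝ) ≤ Real.log (k + k) / Real.log 2 := by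
    simpa [Real.logb] using Real.natLog_le_logb (k + k) 2
  have h2 : Real.log (k + k) = Real.log 2 + Real.log k := by
    rw [← two_mul, Real.log_mul (by norm_num) (by positivity)]
  have h3 : Real.log k ≤ Real.log (k + 1) := Real.log_le_log (by positivity) (by linarith)
  have h4 : Real.log 2 ≤ Real.log (k + 1) := Real.log_le_log (by norm_num) (by linarith)
  rw [h2, le_div_iff₀ hlog2] at h1
  rw [div_mul_eq_mul_div, le_div_iff₀ hlog2]
  push_cast
  linarith

/-- Cuts are all that a sparsifier has to preserve for demands to stay routable up to a logarithmic
factor. -/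
lemma opt_le_of_cut_lower {V E E' : Type*} [Fintype V] [DecidableEq V] [Fintype E] [Fintype E']
    (G : CapGraph V E) (G' : CapGraph V E') {ε : ℝ} (hε : ε < 1)
    (hcut : ∀ S : Finset V, (1 - ε) * G.cutCap S ≤ G'.cutCap S) {k : ℕ} {D : Fin k → V → ℝ}
    (hD : ∀ i, IsPairDemand (D i)) :
    G'.opt D ≤ ENNReal.ofReal (48 / Real.log 2 * Real.log (k + 1) / (1 - ε)) * G.opt D := by
  choose s t d hd hDeq using hD
  obtain rfl : D = fun i => d i • (Pi.single (s i) 1 - Pi.single (t i) 1) := funext hDeq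
  have hε' : 0 < 1 - ε := sub_pos.2 hε
  have hlog2 : 0 < Real.log 2 := Real.log_pos one_lt_two
  rcases Nat.eq_zero_or_pos k with rfl | hk
  · refine (G'.opt_le_of_meets (f := 0) fun i => i.elim0).trans ?_
    simpa using (G'.congestion_le_iff (k := 0) _ le_rfl).2 (by simp)
  have hlog : 0 < Real.log (k + 1) := Real.log_pos (by simpa using hk)
  set K := 48 / Real.log 2 * Real.log (k + 1) / (1 - ε) with hKdef
  have hK : 0 < K := by positivity
  have hK0 : ENNReal.ofReal K ≠ 0 := by simpa using hK
  have hmeets : ∀ f, G.Meets f (fun i => d i • (Pi.single (s i) 1 - Pi.single (t i) 1)) →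
      G'.opt (fun i => d i • (Pi.single (s i) 1 - Pi.single (t i) 1)) ≤
        ENNReal.ofReal K * ENNReal.ofReal (G.congestion f) := by
    intro f hf
    have hcong := G.congestion_nonneg f
    obtain ⟨g, hg, hgD⟩ := G'.exists_meets_of_cut_condition hd
      (c := G.congestion f / (1 - ε)) (by positivity) fun S => by
        refine (G.sum_demand_le_congestion_mul_cutCap hd hf S).trans ?_
        calc G.congestion f * G.cutCap S
            = G.congestion f / (1 - ε) * ((1 - ε) * G.cutCap S) := by field_simp
          _ ≤ _ := by gcongr; exact hcut S
    refine (G'.opt_le_of_meets hgD).trans ?_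
    rw [← ENNReal.ofReal_mul hK.le]
    refine ENNReal.ofReal_le_ofReal (hg.trans ?_)
    calc 16 * (Nat.log 2 (k + k) + 1 : ℕ) * (G.congestion f / (1 - ε))
        ≤ 16 * (3 / Real.log 2 * Real.log (k + 1)) * (G.congestion f / (1 - ε)) := by
          gcongr
          exact natLog_add_one_le k hk
      _ = K * G.congestion f := by rw [hKdef]; ring
  rw [opt, opt, ENNReal.mul_iInf_of_ne hK0 ENNReal.ofReal_ne_top]
  refine le_iInf fun f => ?_
  rw [ENNReal.mul_iInf_of_ne hK0 ENNReal.ofReal_ne_top]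
  exact le_iInf fun hf => hmeets f hf

end CapGraph

theorem mainTheorem4 :
    ∃ C : ℝ, 0 < C ∧
      ∀ (V E E' : Type*) [Fintype V] [DecidableEq V] [Fintype E] [Fintype E']
        (G : CapGraph V E) (G' : CapGraph V E') (M : Matrix E E' ℝ) (h ε α : ℝ),
        ε < 1 → CapGraph.IsFlowSparsification G G' M h ε α →
        ∀ (k : ℕ) (D : Fin k → V → ℝ), (∀ i, IsPairDemand (D i)) →
          G'.opt D ≤ ENNReal.ofReal (C * Real.log (k + 1) / (1 - ε)) * G.opt D ∧
          ((∃ f, G.Meets f D) → ∃ f, G'.IsOptimal f D) ∧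
          ∀ f : Fin k → E' → ℝ, G'.IsOptimal f D →
            ENNReal.ofReal (G.congestion fun i => M *ᵥ f i) ≤ ENNReal.ofReal α * G'.opt D ∧
            ENNReal.ofReal α * G'.opt D ≤
              ENNReal.ofReal (C * α * Real.log (k + 1) / (1 - ε)) * G.opt D := by
  have hlog2 : 0 < Real.log 2 := Real.log_pos one_lt_two
  -- `16` is lost in the averaging over cuts, and there are at most `3 log (k + 1) / log 2` levels.
  refine ⟨48 / Real.log 2, by positivity, ?_⟩
  intro V E E' _ _ _ _ G G' M h ε α hε hM k D hD
  have hopt := G.opt_le_of_cut_lower G' hε hM.cut_lower hD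
  have hα : 0 ≤ α := (CapGraph.embCongestion_nonneg G' G M).trans hM.flow
  refine ⟨hopt, ?_, fun f hf => ⟨?_, ?_⟩⟩
  · rintro ⟨f, hf⟩
    have hfin : G'.opt D < ⊤ := hopt.trans_lt (ENNReal.mul_lt_top ENNReal.ofReal_lt_top
      ((G.opt_le_of_meets hf).trans_lt ENNReal.ofReal_lt_top))
    obtain ⟨g, hg⟩ := iInf_lt_iff.1 hfin
    obtain ⟨hgD, -⟩ := iInf_lt_iff.1 hg
    exact G'.exists_isOptimal hgD
  · rw [hf.opt_eq, ← ENNReal.ofReal_mul hα]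
    refine ENNReal.ofReal_le_ofReal ((CapGraph.congestion_mulVec_le G' G M f).trans ?_)
    exact mul_le_mul_of_nonneg_right hM.flow (G'.congestion_nonneg f)
  · calc ENNReal.ofReal α * G'.opt D
        ≤ ENNReal.ofReal α *
            (ENNReal.ofReal (48 / Real.log 2 * Real.log (k + 1) / (1 - ε)) * G.opt D) := by
          gcongr
      _ = _ := by
          rw [← mul_assoc, ← ENNReal.ofReal_mul hα]
          congr 2
          ring
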